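/- For $n\ge 1$ let $G_n$ be the coprime graph on $[n]=\{1,\dots,n\}$, in which two distinct integers are adjacent if and only if they are coprime, and let $p_m$ denote the $m$-th prime ($p_1=2$). Call a coloring $\chi:[n]\to\{1,\dots,c\}$ \emph{balanced} if the sizes of any two of its $c$ color classes differ by at most one; it has a \emph{monochromatic coprime $K_k$} if some color class contains $k$ pairwise coprime distinct integers, that is, a $k$-clique of $G_n$. Fix an integer $c\ge 2$. Then there is an integer $K=K(c)\ge 2$ such that for every $k\ge K$ there is a balanced $c$-coloring of $[p_{c(k-1)}-1]$ with no monochromatic coprime $K_k$. Consequently, if $L_{\mathrm{bal}}(k;c)$ denotes the largest $n$ for which there is a balanced $c$-coloring of $[n]$ with no monochromatic coprime $K_k$, then for every $k\ge K$ this largest $n$ exists and \[ L_{\mathrm{bal}}(k;c)=p_{c(k-1)}-1 . \] -/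

import Mathlib

namespace CoprimeRamsey

/-- The coprime graph on `[n] = {1, …, n}`: distinct vertices are adjacent iff they are coprime. -/
def coprimeGraph (n : ℕ) : SimpleGraph (Finset.Icc 1 n) where
  Adj a b := a ≠ b ∧ Nat.Coprime (a : ℕ) (b : ℕ)
  symm := ⟨fun _ _ h => ⟨h.1.symm, h.2.symm⟩⟩
  loopless := ⟨fun _ h => h.1 rfl⟩

/-- The color class of the color `i`. -/
def colorClass {n c : ℕ} (χ : Finset.Icc 1 n → Fin c) (i : Fin c) :
    Finset (Finset.Icc 1 n) :=
  Finset.univ.filter (fun v => χ v = i)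

/-- A coloring is balanced if the sizes of any two color classes differ by at most one. -/
def IsBalanced {n c : ℕ} (χ : Finset.Icc 1 n → Fin c) : Prop :=
  ∀ i j : Fin c, (colorClass χ i).card ≤ (colorClass χ j).card + 1

/-- Some color class contains a `k`-clique of the coprime graph. -/
def HasMonochromaticClique {n c : ℕ} (χ : Finset.Icc 1 n → Fin c) (k : ℕ) : Prop :=
  ∃ i : Fin c, ∃ s : Finset (Finset.Icc 1 n),
    s ⊆ colorClass χ i ∧ (coprimeGraph n).IsNClique k s

/-- The set of all `n` for which `[n]` has a balanced `c`-coloring with no monochromatic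
coprime `K_k`. -/
def balancedAvoiding (k c : ℕ) : Set ℕ :=
  {n | ∃ χ : Finset.Icc 1 n → Fin c, IsBalanced χ ∧ ¬ HasMonochromaticClique χ k}

/-- The balanced endpoint: the largest `n` in `balancedAvoiding k c` (the supremum in `ℕ`, which
is the largest element when the set is nonempty and bounded). -/
noncomputable def Lbal (k c : ℕ) : ℕ := sSup (balancedAvoiding k c)

/-- The `m`-th prime for `m ≥ 1`, counted from `p_1 = 2`. -/
noncomputable def nthPrime (m : ℕ) : ℕ := Nat.nth Nat.Prime (m - 1)

end CoprimeRamsey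

namespace CoprimeRamsey

/-! Color each integer above 1 by the index modulo `c` of one of its prime divisors, and treat 1 as
a prime with the next unused index. Below `nthPrime (c * (k - 1))` each color then owns exactly `k -
1` indices. Pairwise coprime integers of one color use distinct indices, so no class contains a
`k`-clique.

Balance comes from the freedom to choose the prime divisor. The primes of one color have divergent
reciprocal sum, so the integers missing some color have density zero
(`eventually_card_not_allowed_le`). All other integers accept every color and can even out the class
sizes (`exists_balanced_list_coloring`). -/

/-- The residue class modulo `c` of the index of the prime `p`, where the primes are indexed
from `0`. -/
noncomputable def primeColor (c p : ℕ) : ℕ := Nat.count Nat.Prime p % c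

/-- The colors allowed for `m`: the integer `1` takes the color `c - 1`, every other integer may
take the color of any of its prime divisors. -/
def Allowed (c m i : ℕ) : Prop :=
  (m = 1 ∧ i = c - 1) ∨ ∃ p, p.Prime ∧ p ∣ m ∧ primeColor c p = i

/-! ### Density of the integers that miss a color -/

/-- The reciprocals of the primes of a given color have a divergent sum. -/
theorem not_summable_one_div_nth_prime_of_mod (c i : ℕ) [NeZero c] :
    ¬ Summable ({j : ℕ | (j : ZMod c) = (i : ZMod c)}.indicator
      fun j => (1 : ℝ) / Nat.nth Nat.Prime j) := by
  -- For an antitone sequence, summability along one residue class is equivalent to summability of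
  -- the whole sequence.
  rw [summable_indicator_mod_iff]
  · intro h
    apply Nat.Primes.not_summable_one_div
    have hf : Function.Injective fun p : Nat.Primes => Nat.count Nat.Prime p := by
      intro p q hpq
      exact Subtype.ext (Nat.count_injective p.2 q.2 hpq)
    refine (h.comp_injective hf).congr fun p => ?_
    simp [Nat.nth_count p.2]
  · intro a b hab
    have h : Nat.nth Nat.Prime a ≤ Nat.nth Nat.Prime b :=
      (Nat.nth_monotone Nat.infinite_setOfPred_prime) hab
    have h0 : 0 < Nat.nth Nat.Prime a := (Nat.prime_nth_prime a).pos
    show (1 : ℝ) / _ ≤ 1 / _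
    gcongr

/-- Divergence of the reciprocal sum passes to the product through `1 - x ≤ exp (-x)`. -/
theorem exists_primes_of_color_prod_lt {c i : ℕ} (hi : i < c) {ε : ℝ} (hε : 0 < ε) :
    ∃ s : Finset ℕ, (∀ p ∈ s, p.Prime ∧ primeColor c p = i) ∧
      ∏ p ∈ s, (1 - (p : ℝ)⁻¹) < ε := by
  have : NeZero c := ⟨by omega⟩
  have hns := not_summable_one_div_nth_prime_of_mod c i
  set f := {j : ℕ | (j : ZMod c) = (i : ZMod c)}.indicator
      fun j => (1 : ℝ) / Nat.nth Nat.Prime j with hf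
  have hf0 : ∀ j, 0 ≤ f j := fun j => Set.indicator_nonneg (fun _ _ => by positivity) j
  have ht := (not_summable_iff_tendsto_nat_atTop_of_nonneg hf0).1 hns
  obtain ⟨n, hn⟩ := (ht.eventually_gt_atTop (-Real.log ε)).exists
  let t := (Finset.range n).filter fun j : ℕ => (j : ZMod c) = (i : ZMod c)
  refine ⟨t.image (Nat.nth Nat.Prime), ?_, ?_⟩
  · intro p hp
    obtain ⟨j, hj, rfl⟩ := Finset.mem_image.1 hp
    refine ⟨Nat.prime_nth_prime j, ?_⟩
    have hj' := (Finset.mem_filter.1 hj).2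
    rw [ZMod.natCast_eq_natCast_iff'] at hj'
    rw [primeColor, Nat.count_nth_of_infinite Nat.infinite_setOfPred_prime, hj', Nat.mod_eq_of_lt hi]
  · rw [Finset.prod_image
      fun a _ b _ h => Nat.nth_injective Nat.infinite_setOfPred_prime h]
    have hsum : ∑ j ∈ Finset.range n, f j = ∑ j ∈ t, ((Nat.nth Nat.Prime j : ℕ) : ℝ)⁻¹ := by
      rw [Finset.sum_filter]
      refine Finset.sum_congr rfl fun j _ => ?_
      simp [hf, Set.indicator_apply]
    rw [hsum] at hn
    calc ∏ j ∈ t, (1 - ((Nat.nth Nat.Prime j : ℕ) : ℝ)⁻¹)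
        ≤ ∏ j ∈ t, Real.exp (-((Nat.nth Nat.Prime j : ℕ) : ℝ)⁻¹) := by
          refine Finset.prod_le_prod (fun j _ => ?_) fun j _ => Real.one_sub_le_exp_neg _
          rw [sub_nonneg]
          exact inv_le_one_of_one_le₀ (by exact_mod_cast (Nat.prime_nth_prime j).one_le)
      _ = Real.exp (-∑ j ∈ t, ((Nat.nth Nat.Prime j : ℕ) : ℝ)⁻¹) := by
          rw [← Real.exp_sum, Finset.sum_neg_distrib]
      _ < Real.exp (Real.log ε) := Real.exp_lt_exp.2 (by linarith)
      _ = ε := Real.exp_log hε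

/-- The integers without a prime divisor of a given color have density zero. -/
theorem eventually_card_not_allowed_le {c i : ℕ} (hi : i < c) {D : ℕ} (hD : 0 < D) :
    ∀ᶠ n : ℕ in Filter.atTop, ∀ s ⊆ Finset.Icc 1 n, (∀ m ∈ s, ¬ Allowed c m i) →
      D * s.card ≤ n := by
  -- The factor 2 absorbs the incomplete last period: `n / M + 1` periods of length `M` cover at
  -- most `2 * n` once `M ≤ n`.
  obtain ⟨P, hP, hprod⟩ := exists_primes_of_color_prod_lt hi (ε := 1 / (2 * D)) (by positivity)
  set M := ∏ p ∈ P, p with hM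
  have hMpos : 0 < M := Finset.prod_pos fun p hp => (hP p hp).1.pos
  have htot : (2 * D) * M.totient ≤ M := by
    have h1 := Nat.totient_eq_mul_prod_factors M
    rw [hM, Nat.primeFactors_prod fun p hp => (hP p hp).1, ← hM] at h1
    have h2 : (M.totient : ℝ) = M * ∏ p ∈ P, (1 - (p : ℝ)⁻¹) := by
      have := congrArg (fun q : ℚ => (q : ℝ)) h1
      push_cast at this
      exact this
    have h3 : (M.totient : ℝ) ≤ M * (1 / (2 * D)) := by
      rw [h2]; gcongr
    have h4 : (2 * D : ℝ) * M.totient ≤ M := by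
      calc (2 * D : ℝ) * M.totient ≤ (2 * D) * (M * (1 / (2 * D))) := by gcongr
        _ = M := by field_simp
    exact_mod_cast h4
  filter_upwards [Filter.eventually_ge_atTop M] with n hn s hs hna
  have hsub : s ⊆ {x ∈ Finset.Ico 1 (1 + n) | M.Coprime x} := by
    intro m hm
    have hm' := Finset.mem_Icc.1 (hs hm)
    refine Finset.mem_filter.2 ⟨Finset.mem_Ico.2 (by omega), ?_⟩
    refine Nat.Coprime.prod_left fun p hp => ?_
    rw [(hP p hp).1.coprime_iff_not_dvd]
    exact fun hdvd => hna m hm (Or.inr ⟨p, (hP p hp).1, hdvd, (hP p hp).2⟩)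
  have hcard : s.card ≤ M.totient * (n / M + 1) :=
    (Finset.card_le_card hsub).trans (Nat.Ico_filter_coprime_le 1 n hMpos.ne')
  have h5 : n / M * M ≤ n := Nat.div_mul_le_self n M
  have h6 : (2 * D) * s.card ≤ 2 * n :=
    calc (2 * D) * s.card ≤ (2 * D) * (M.totient * (n / M + 1)) := by gcongr
      _ = ((2 * D) * M.totient) * (n / M + 1) := by ring
      _ ≤ M * (n / M + 1) := by gcongr
      _ = n / M * M + M := by ring
      _ ≤ 2 * n := by omega
  nlinarith

/-! ### Balancing a list coloring -/

/-- If all but at most a `1 / c` fraction of the points may take any color, a coloring from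
lists can be chosen balanced. -/
theorem exists_balanced_list_coloring {V : Type*} [Fintype V] [DecidableEq V] {c : ℕ}
    (hc : 0 < c) (A : V → Fin c → Prop) (hA : ∀ v, ∃ i, A v i) (B : Finset V)
    (hB : ∀ v ∉ B, ∀ i, A v i) (hcard : c * B.card ≤ Fintype.card V) :
    ∃ χ : V → Fin c, (∀ v, A v (χ v)) ∧ ∀ i j : Fin c,
      (Finset.univ.filter fun v => χ v = i).card ≤
        (Finset.univ.filter fun v => χ v = j).card + 1 := by
  have : NeZero c := ⟨hc.ne'⟩
  -- Color `B` arbitrarily, then give each new point a least-used color. A class larger than `B`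
  -- exceeds every other class by at most one.
  have key : ∀ S : Finset V, Disjoint S B → ∃ χ : V → Fin c, (∀ v, A v (χ v)) ∧
      ∀ i j : Fin c,
        ((B ∪ S).filter fun v => χ v = i).card ≤ ((B ∪ S).filter fun v => χ v = j).card + 1 ∨
        ((B ∪ S).filter fun v => χ v = i).card ≤ B.card := by
    intro S
    induction S using Finset.induction_on with
    | empty =>
      intro _
      choose g hg using hA
      refine ⟨g, hg, fun i j => Or.inr ?_⟩
      rw [Finset.union_empty]
      exact Finset.card_filter_le _ _
    | insert a S ha ih =>
      intro hdis
      obtain ⟨haB, hdis'⟩ := Finset.disjoint_insert_left.1 hdis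
      obtain ⟨χ, hχ, hbal⟩ := ih hdis'
      obtain ⟨l, -, hl⟩ := Finset.exists_min_image (Finset.univ : Finset (Fin c))
        (fun i => ((B ∪ S).filter fun v => χ v = i).card) Finset.univ_nonempty
      have haT : a ∉ B ∪ S := by simp [ha, haB]
      refine ⟨Function.update χ a l, fun v => ?_, ?_⟩
      · by_cases hv : v = a
        · subst hv; exact hB _ haB _
        · rw [Function.update_of_ne hv]; exact hχ v
      have hcount : ∀ i, ((B ∪ insert a S).filter fun v => Function.update χ a l v = i).card =
          ((B ∪ S).filter fun v => χ v = i).card + if l = i then 1 else 0 := by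
        intro i
        have hcongr : ((B ∪ S).filter fun v => Function.update χ a l v = i) =
            (B ∪ S).filter fun v => χ v = i := by
          refine Finset.filter_congr fun v hv => ?_
          rw [Function.update_of_ne (ne_of_mem_of_not_mem hv haT)]
        rw [Finset.union_insert, Finset.filter_insert, hcongr, Function.update_self]
        split_ifs with h
        · rw [Finset.card_insert_of_notMem (fun h' => haT (Finset.mem_filter.1 h').1)]
        · rfl
      intro i j
      rw [hcount, hcount]
      have h1 := hl j (Finset.mem_univ j)
      by_cases hli : l = i
      · subst hli
        left
        rw [if_pos rfl]
        omega
      · rw [if_neg hli]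
        rcases hbal i j with h | h
        · left; omega
        · right; omega
  obtain ⟨χ, hχ, hbal⟩ := key Bᶜ disjoint_compl_left
  rw [Finset.union_compl] at hbal
  refine ⟨χ, hχ, fun i j => ?_⟩
  -- An imbalance forces every class to size at most `B.card`, and class `j` strictly below it, so
  -- the classes cannot cover `V`.
  by_contra! hlt
  have hi := (hbal i j).resolve_left (by omega)
  have hall : ∀ l ∈ (Finset.univ : Finset (Fin c)),
      (Finset.univ.filter fun v => χ v = l).card ≤ B.card := by
    intro l _
    rcases hbal l j with h | h <;> omega
  have hsum : Fintype.card V < c * B.card := by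
    calc Fintype.card V = ∑ l : Fin c, (Finset.univ.filter fun v => χ v = l).card :=
          Finset.card_eq_sum_card_fiberwise fun v _ => Finset.mem_coe.2 (Finset.mem_univ (χ v))
      _ < ∑ _l : Fin c, B.card :=
          Finset.sum_lt_sum hall ⟨j, Finset.mem_univ j, by omega⟩
      _ = c * B.card := by simp
  omega

/-! ### Cliques: the lower and upper bounds -/

/-- A coloring that gives each integer an allowed color has no large monochromatic clique. -/
theorem not_hasMonochromaticClique_of_allowed {c k : ℕ} (hc : 0 < c) (hk : 2 ≤ k)
    (χ : Finset.Icc 1 (nthPrime (c * (k - 1)) - 1) → Fin c)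
    (hχ : ∀ v : Finset.Icc 1 (nthPrime (c * (k - 1)) - 1), Allowed c v (χ v)) :
    ¬ HasMonochromaticClique χ k := by
  rintro ⟨i, s, hs, hclique⟩
  have hpos : 0 < c * (k - 1) := Nat.mul_pos hc (by omega)
  -- The largest index, of residue `c - 1`, belongs to the excluded prime `nthPrime (c * (k - 1))`,
  -- so it is free for 1.
  have hidx : ∀ v : Finset.Icc 1 (nthPrime (c * (k - 1)) - 1), ∃ j, j < c * (k - 1) ∧
      j % c = χ v ∧ (((v : ℕ) = 1 ∧ j = c * (k - 1) - 1) ∨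
        (j < c * (k - 1) - 1 ∧ Nat.nth Nat.Prime j ∣ v)) := by
    intro v
    have hv := Finset.mem_Icc.1 v.2
    rcases hχ v with ⟨h1, h2⟩ | ⟨p, hp, hpv, hcol⟩
    · refine ⟨c * (k - 1) - 1, by omega, ?_, Or.inl ⟨h1, rfl⟩⟩
      obtain ⟨r, hr⟩ : ∃ r, k - 1 = r + 1 := ⟨k - 2, by omega⟩
      have : c * (r + 1) - 1 = (c - 1) + c * r := by rw [Nat.mul_succ]; omega
      rw [h2, hr, this, Nat.add_mul_mod_self_left, Nat.mod_eq_of_lt (by omega)]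
    · have hle : p ≤ v := Nat.le_of_dvd (by omega) hpv
      have hlt : p < Nat.nth Nat.Prime (c * (k - 1) - 1) := by
        have : 0 < nthPrime (c * (k - 1)) := (Nat.prime_nth_prime _).pos
        have : p < nthPrime (c * (k - 1)) := by omega
        exact this
      have hj : Nat.count Nat.Prime p < c * (k - 1) - 1 := by
        rw [← Nat.nth_lt_nth Nat.infinite_setOfPred_prime, Nat.nth_count hp]
        exact hlt
      exact ⟨Nat.count Nat.Prime p, by omega, hcol, Or.inr ⟨hj, by rwa [Nat.nth_count hp]⟩⟩
  choose f hf hfc hfd using hidx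
  have hcol : ∀ v ∈ s, χ v = i := fun v hv => (Finset.mem_filter.1 (hs hv)).2
  have hcard : s.card ≤ (Finset.range (k - 1)).card := by
    refine Finset.card_le_card_of_injOn (fun v => f v / c) ?_ ?_
    · intro v _
      simpa using Nat.div_lt_of_lt_mul (hf v)
    · intro v hv w hw hvw
      have heq : f v = f w := by
        rw [← Nat.div_add_mod (f v) c, ← Nat.div_add_mod (f w) c, hfc, hfc, hcol v hv, hcol w hw]
        simp only at hvw
        rw [hvw]
      by_contra hne
      have hcop : Nat.Coprime (v : ℕ) (w : ℕ) := (hclique.isClique hv hw hne).2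
      rcases hfd v with ⟨hv1, hv2⟩ | ⟨hv1, hv2⟩ <;> rcases hfd w with ⟨hw1, hw2⟩ | ⟨hw1, hw2⟩
      · exact hne (Subtype.ext (hv1.trans hw1.symm))
      · omega
      · omega
      · rw [← heq] at hw2
        exact Nat.not_coprime_of_dvd_of_dvd (Nat.prime_nth_prime _).one_lt hv2 hw2 hcop
  rw [hclique.card_eq, Finset.card_range] at hcard
  omega

/-- `1` and the first `c * (k - 1)` primes force a monochromatic clique. -/
theorem hasMonochromaticClique_of_nthPrime_le {c k n : ℕ} (hc : 0 < c) (hk : 2 ≤ k)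
    (hn : nthPrime (c * (k - 1)) ≤ n) (χ : Finset.Icc 1 n → Fin c) :
    HasMonochromaticClique χ k := by
  have hpos : 0 < c * (k - 1) := Nat.mul_pos hc (by omega)
  let g : ℕ → ℕ := fun j => if j = 0 then 1 else Nat.nth Nat.Prime (j - 1)
  have hg : ∀ j : Fin (c * (k - 1) + 1), g j ∈ Finset.Icc 1 n := by
    intro j
    have hj := j.2
    rw [Finset.mem_Icc]
    have hmono : Nat.nth Nat.Prime ((j : ℕ) - 1) ≤ nthPrime (c * (k - 1)) :=
      Nat.nth_monotone Nat.infinite_setOfPred_prime (by omega)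
    have h1 := (Nat.prime_nth_prime ((j : ℕ) - 1)).one_le
    by_cases h : (j : ℕ) = 0
    · simp only [g, h, if_true]; omega
    · simp only [g, h, if_false]; omega
  have hcop : ∀ a b : ℕ, a ≠ b → Nat.Coprime (g a) (g b) := by
    intro a b hab
    by_cases ha : a = 0
    · simp [g, ha]
    by_cases hb : b = 0
    · simp [g, hb]
    simp only [g, ha, hb, if_false]
    rw [Nat.coprime_primes (Nat.prime_nth_prime _) (Nat.prime_nth_prime _)]
    intro h
    have := Nat.nth_injective Nat.infinite_setOfPred_prime h
    omega
  have hinj : Function.Injective g := by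
    intro a b hab
    by_contra hne
    have h1 := hcop a b hne
    rw [hab, Nat.coprime_self] at h1
    have h2 := hab.trans h1
    have : ∀ j, g j = 1 → j = 0 := by
      intro j hj
      by_contra h
      simp only [g, h, if_false] at hj
      exact (Nat.prime_nth_prime _).one_lt.ne' hj
    exact hne ((this a h2).trans (this b h1).symm)
  let e : Fin (c * (k - 1) + 1) → Finset.Icc 1 n := fun j => ⟨g j, hg j⟩
  have he : Function.Injective e := fun a b h => Fin.ext (hinj (congrArg Subtype.val h))
  obtain ⟨i, hi⟩ := Fintype.exists_lt_card_fiber_of_mul_lt_card (fun j => χ (e j)) (n := k - 1)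
    (by simp)
  obtain ⟨t, ht, htk⟩ := Finset.exists_subset_card_eq (show k ≤ _ by omega : k ≤
    (Finset.univ.filter fun j => χ (e j) = i).card)
  refine ⟨i, t.image e, ?_, ?_, ?_⟩
  · intro v hv
    obtain ⟨j, hj, rfl⟩ := Finset.mem_image.1 hv
    exact Finset.mem_filter.2 ⟨Finset.mem_univ _, (Finset.mem_filter.1 (ht hj)).2⟩
  · intro v hv w hw hne
    obtain ⟨a, -, rfl⟩ := Finset.mem_image.1 (Finset.mem_coe.1 hv)
    obtain ⟨b, -, rfl⟩ := Finset.mem_image.1 (Finset.mem_coe.1 hw)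
    exact ⟨hne, hcop a b fun h => hne (congrArg e (Fin.ext h))⟩
  · rw [Finset.card_image_of_injective _ he, htk]

/-! ### Assembly -/

/-- For large `n` there is a balanced coloring of `[n]` by allowed colors. -/
theorem eventually_exists_balanced_allowed {c : ℕ} (hc : 0 < c) :
    ∀ᶠ n : ℕ in Filter.atTop, ∃ χ : Finset.Icc 1 n → Fin c,
      (∀ v : Finset.Icc 1 n, Allowed c v (χ v)) ∧ IsBalanced χ := by
  classical
  -- The bound `n / c ^ 2` per color leaves `n / c` after the union over `c` colors.
  have hev : ∀ᶠ n : ℕ in Filter.atTop, ∀ i : Fin c, ∀ s ⊆ Finset.Icc 1 n,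
      (∀ m ∈ s, ¬ Allowed c m i) → (c * c) * s.card ≤ n :=
    Filter.eventually_all.2 fun i => eventually_card_not_allowed_le i.2 (Nat.mul_pos hc hc)
  filter_upwards [hev] with n hn
  let N : Fin c → Finset (Finset.Icc 1 n) := fun i =>
    Finset.univ.filter fun v => ¬ Allowed c (v : ℕ) i
  have hN : ∀ i, (c * c) * (N i).card ≤ n := by
    intro i
    rw [← Finset.card_map (Function.Embedding.subtype _)]
    refine hn i _ ?_ ?_
    · intro m hm
      obtain ⟨v, -, rfl⟩ := Finset.mem_map.1 hm
      exact v.2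
    · intro m hm
      obtain ⟨v, hv, rfl⟩ := Finset.mem_map.1 hm
      exact (Finset.mem_filter.1 hv).2
  refine exists_balanced_list_coloring hc (fun (v : Finset.Icc 1 n) i => Allowed c v i) ?_
    (Finset.univ.biUnion N) ?_ ?_
  · intro v
    by_cases hv : (v : ℕ) = 1
    · exact ⟨⟨c - 1, by omega⟩, Or.inl ⟨hv, rfl⟩⟩
    · obtain ⟨p, hp, hpv⟩ := Nat.exists_prime_and_dvd hv
      exact ⟨⟨primeColor c p, Nat.mod_lt _ hc⟩, Or.inr ⟨p, hp, hpv, rfl⟩⟩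
  · intro v hv i
    by_contra h
    exact hv (Finset.mem_biUnion.2 ⟨i, Finset.mem_univ i, Finset.mem_filter.2
      ⟨Finset.mem_univ v, h⟩⟩)
  · have h1 : (Finset.univ.biUnion N).card ≤ ∑ i, (N i).card := Finset.card_biUnion_le
    have h2 : c * (c * ∑ i, (N i).card) ≤ c * n := by
      calc c * (c * ∑ i, (N i).card) = ∑ i, (c * c) * (N i).card := by
            rw [← mul_assoc, Finset.mul_sum]
        _ ≤ ∑ _i : Fin c, n := Finset.sum_le_sum fun i _ => hN i
        _ = c * n := by simp
    have h3 := Nat.le_of_mul_le_mul_left h2 hc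
    calc c * (Finset.univ.biUnion N).card ≤ c * ∑ i, (N i).card := by gcongr
      _ ≤ n := h3
      _ = Fintype.card (Finset.Icc 1 n) := by simp

end CoprimeRamsey

theorem mainTheorem4 (c : ℕ) (hc : 2 ≤ c) :
    ∃ K : ℕ, 2 ≤ K ∧ ∀ k : ℕ, K ≤ k →
      (∃ χ : Finset.Icc 1 (CoprimeRamsey.nthPrime (c * (k - 1)) - 1) → Fin c,
        CoprimeRamsey.IsBalanced χ ∧ ¬ CoprimeRamsey.HasMonochromaticClique χ k) ∧
      IsGreatest (CoprimeRamsey.balancedAvoiding k c) (CoprimeRamsey.Lbal k c) ∧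
      CoprimeRamsey.Lbal k c = CoprimeRamsey.nthPrime (c * (k - 1)) - 1 := by
  have hc0 : 0 < c := by omega
  obtain ⟨N, hN⟩ := Filter.eventually_atTop.1
    (CoprimeRamsey.eventually_exists_balanced_allowed hc0)
  refine ⟨N + 2, by omega, fun k hk => ?_⟩
  have hlarge : N ≤ CoprimeRamsey.nthPrime (c * (k - 1)) - 1 := by
    have h1 : c * (k - 1) - 1 + 2 ≤ CoprimeRamsey.nthPrime (c * (k - 1)) :=
      Nat.add_two_le_nth_prime _
    have h2 : 1 * (k - 1) ≤ c * (k - 1) := Nat.mul_le_mul_right _ (by omega)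
    omega
  obtain ⟨χ, hχ, hbal⟩ := hN _ hlarge
  have hex : CoprimeRamsey.nthPrime (c * (k - 1)) - 1 ∈ CoprimeRamsey.balancedAvoiding k c :=
    ⟨χ, hbal, CoprimeRamsey.not_hasMonochromaticClique_of_allowed hc0 (by omega) χ hχ⟩
  have hgreatest : IsGreatest (CoprimeRamsey.balancedAvoiding k c)
      (CoprimeRamsey.nthPrime (c * (k - 1)) - 1) := by
    refine ⟨hex, ?_⟩
    rintro n ⟨ψ, -, hψ⟩
    by_contra! hlt
    exact hψ (CoprimeRamsey.hasMonochromaticClique_of_nthPrime_le hc0 (by omega) (by omega) ψ)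
  have hL : CoprimeRamsey.Lbal k c = CoprimeRamsey.nthPrime (c * (k - 1)) - 1 :=
    hgreatest.csSup_eq
  exact ⟨hex, hL ▸ hgreatest, hL⟩
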